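/- Let $\Gamma$ be a countable (discrete) group and let $(Y,\mathcal Y,\mu)$ be a standard Borel probability space without atoms (for example the circle $[0,1)$ with Lebesgue measure). A $\Gamma$-action on $(Y,\mu)$ is a family $\mathbf T=(T^\gamma)_{\gamma\in\Gamma}$ of $\mu$-preserving measurable maps $Y\to Y$ such that $T^{e}=\mathrm{id}$ and $T^{\beta\alpha}=T^\beta\circ T^\alpha$ for all $\alpha,\beta\in\Gamma$. Let $\mathbb A_\Gamma$ be the set of these actions, where $\mathbf T$ and $\mathbf R$ are identified if $T^\gamma=R^\gamma$ $\mu$-a.e. for every $\gamma$, with the coarse topology: $\mathbf T_i\to\mathbf R$ iff $\mu\bigl((T_i^\gamma)^{-1}(E)\,\triangle\,(R^\gamma)^{-1}(E)\bigr)\to0$ for every $\gamma\in\Gamma$ and every measurable $E\subseteq Y$. A measure-preserving action $\mathbf T$ of $\Gamma$ on a probability space is free if for almost every point $y$ the map $\gamma\mapsto T^\gamma(y)$ is injective on $\Gamma$. Let ${}^\bullet\mathrm{SIM}$ be the set of Borel probability measures on $\mathbb T^{\Gamma}$ ($\mathbb T=\mathbb R/\mathbb Z$) that are invariant under every shift $S^\alpha$,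 $(S^\alpha \hat y)[\gamma]=\hat y[\gamma\alpha]$, with the weak-* topology. Then: 1. The set of free $\Gamma$-actions is residual in $\mathbb A_\Gamma$ and dense in $\mathbb A_\Gamma$. 2. The set of those $\hat\mu\in{}^\bullet\mathrm{SIM}$ for which the shift action $(S^\alpha)_{\alpha\in\Gamma}$ on $(\mathbb T^{\Gamma},\hat\mu)$ is free is a dense $G_\delta$ subset of ${}^\bullet\mathrm{SIM}$. -/

import Mathlib

open MeasureTheory Filter Topology
open scoped symmDiff

/-- A measure-preserving action of the (discrete) group `Γ` on `(Y, μ)`: measure-preserving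
maps `T γ`, with `T 1 = id` and `T (β * α) = T β ∘ T α`. Each `T γ` is measurable (as part of
`MeasurePreserving`), which for countable discrete `Γ` is joint measurability on `Γ × Y`. -/
structure MPAction (Γ : Type*) [Group Γ] {Y : Type*} [MeasurableSpace Y] (μ : Measure Y) where
  /-- The transformation at time `γ`. -/
  map : Γ → Y → Y
  measurePreserving : ∀ γ, MeasurePreserving (map γ) μ μ
  map_one : map 1 = id
  map_mul : ∀ β α, map (β * α) = map β ∘ map α

namespace MPAction

/-- The action is free: for almost every `y`, the orbit map `γ ↦ T^γ(y)` is injective. -/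
def IsFree {Γ : Type*} [Group Γ] {Y : Type*} [MeasurableSpace Y] {μ : Measure Y}
    (T : MPAction Γ μ) : Prop :=
  ∀ᵐ y ∂μ, Function.Injective fun γ => T.map γ y

/-- The family of all preimages `(T^γ)⁻¹(E)`, for `γ : Γ` and `E` measurable. The space
`MeasuredSets μ` carries the pseudometric `(A, B) ↦ μ (A ∆ B)`. -/
def preimages {Γ : Type*} [Group Γ] {Y : Type*} [MeasurableSpace Y] {μ : Measure Y}
    (T : MPAction Γ μ) (p : Γ × MeasuredSets μ) : MeasuredSets μ :=
  ⟨T.map p.1 ⁻¹' (p.2 : Set Y), (T.measurePreserving p.1).measurable p.2.2⟩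

/-- The coarse topology: `T_i → R` iff `μ ((T_i^γ)⁻¹(E) ∆ (R^γ)⁻¹(E)) → 0` for all `γ` and all
measurable `E`. -/
noncomputable instance coarseTopology (Γ : Type*) [Group Γ] {Y : Type*} [MeasurableSpace Y] (μ : Measure Y) :
    TopologicalSpace (MPAction Γ μ) :=
  TopologicalSpace.induced preimages inferInstance

theorem tendsto_iff {Γ : Type*} [Group Γ] {Y : Type*} [MeasurableSpace Y] {μ : Measure Y}
    {ι : Type*} {l : Filter ι} {T : ι → MPAction Γ μ} {R : MPAction Γ μ} :
    Tendsto T l (𝓝 R) ↔ ∀ (γ : Γ) (E : Set Y), MeasurableSet E →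
      Tendsto (fun i => μ (((T i).map γ ⁻¹' E) ∆ (R.map γ ⁻¹' E))) l (𝓝 0) := by
  rw [(Topology.IsInducing.mk rfl : Topology.IsInducing
    (preimages : MPAction Γ μ → _)).tendsto_nhds_iff, tendsto_pi_nhds]
  constructor
  · intro h γ E hE
    exact tendsto_iff_edist_tendsto_0.1 (h (γ, ⟨E, hE⟩))
  · rintro h ⟨γ, E⟩
    exact tendsto_iff_edist_tendsto_0.2 (h γ E.1 E.2)

/-- Two actions are identified if at every time they agree almost everywhere. -/
def aeSetoid (Γ : Type*) [Group Γ] {Y : Type*} [MeasurableSpace Y] (μ : Measure Y) :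
    Setoid (MPAction Γ μ) where
  r T R := ∀ γ, T.map γ =ᵐ[μ] R.map γ
  iseqv :=
    { refl := fun _ _ => Filter.EventuallyEq.rfl
      symm := fun h γ => (h γ).symm
      trans := fun h k γ => (h γ).trans (k γ) }

theorem isFree_congr {Γ : Type*} [Group Γ] [Countable Γ] {Y : Type*} [MeasurableSpace Y]
    {μ : Measure Y} {T R : MPAction Γ μ} (h : ∀ γ, T.map γ =ᵐ[μ] R.map γ) :
    T.IsFree ↔ R.IsFree := by
  have key : ∀ᵐ y ∂μ, ∀ γ, T.map γ y = R.map γ y := ae_all_iff.2 h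
  unfold IsFree
  refine Filter.eventually_congr ?_
  filter_upwards [key] with y hy
  rw [funext hy]

end MPAction

/-- The space `𝔸_Γ` of `Γ`-actions on `(Y, μ)`, modulo almost everywhere equality. -/
def ActionSpace (Γ : Type*) [Group Γ] {Y : Type*} [MeasurableSpace Y] (μ : Measure Y) :=
  Quotient (MPAction.aeSetoid Γ μ)

namespace ActionSpace

/-- The coarse topology on `𝔸_Γ`. -/
noncomputable instance coarseTopology (Γ : Type*) [Group Γ] {Y : Type*} [MeasurableSpace Y] (μ : Measure Y) :
    TopologicalSpace (ActionSpace Γ μ) :=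
  inferInstanceAs (TopologicalSpace (Quotient (MPAction.aeSetoid Γ μ)))

/-- The class of an action modulo almost everywhere equality. -/
def mk {Γ : Type*} [Group Γ] {Y : Type*} [MeasurableSpace Y] {μ : Measure Y}
    (T : MPAction Γ μ) : ActionSpace Γ μ :=
  Quotient.mk (MPAction.aeSetoid Γ μ) T

/-- Passing to classes does not change the topology: the topology of `MPAction Γ μ` is the one
induced from `𝔸_Γ`. -/
theorem isInducing_mk {Γ : Type*} [Group Γ] {Y : Type*} [MeasurableSpace Y] {μ : Measure Y} :
    Topology.IsInducing (mk : MPAction Γ μ → ActionSpace Γ μ) := by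
  have hq : Topology.IsQuotientMap (mk : MPAction Γ μ → ActionSpace Γ μ) :=
    isQuotientMap_quot_mk
  refine ⟨le_antisymm hq.continuous.le_induced ?_⟩
  intro s hs
  have hsat : ∀ T R : MPAction Γ μ, (∀ γ, T.map γ =ᵐ[μ] R.map γ) → T ∈ s → R ∈ s := by
    intro T R h hT
    have hi : Inseparable T R := by
      rw [(Topology.IsInducing.mk rfl : Topology.IsInducing
        (MPAction.preimages : MPAction Γ μ → _)).inseparable_iff.symm, inseparable_pi]
      rintro ⟨γ, E⟩
      rw [EMetric.inseparable_iff]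
      have : T.map γ ⁻¹' (E : Set Y) =ᵐ[μ] R.map γ ⁻¹' (E : Set Y) := by
        filter_upwards [h γ] with y hy
        change (T.map γ y ∈ (E : Set Y)) = (R.map γ y ∈ (E : Set Y))
        rw [hy]
      exact measure_symmDiff_eq_zero_iff.2 this
    exact (hi.mem_open_iff hs).1 hT
  have hpre : (mk : MPAction Γ μ → ActionSpace Γ μ) ⁻¹' (mk '' s) = s := by
    refine Set.Subset.antisymm ?_ (Set.subset_preimage_image _ _)
    rintro R ⟨T, hT, hTR⟩
    exact hsat T R (Quotient.exact hTR) hT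
  exact ⟨mk '' s, hq.isOpen_preimage.1 (hpre.symm ▸ hs), hpre⟩

/-- Freeness of an element of `𝔸_Γ`; it does not depend on the representing action. -/
def IsFree {Γ : Type*} [Group Γ] [Countable Γ] {Y : Type*} [MeasurableSpace Y] {μ : Measure Y}
    (T : ActionSpace Γ μ) : Prop :=
  Quotient.lift (s := MPAction.aeSetoid Γ μ) MPAction.IsFree
    (fun _ _ h => propext (MPAction.isFree_congr h)) T

end ActionSpace

/-- The shift at time `α` on the product of copies of the circle:
`(S^α ŷ)[γ] = ŷ[γ α]`. -/
def torusShift {Γ : Type*} [Group Γ] (α : Γ) (y : Γ → UnitAddCircle) : Γ → UnitAddCircle :=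
  fun γ => y (γ * α)

/-- The shift-invariant Borel probability measures ("sims") on the product over `Γ` of copies of
the circle. As a subtype of `ProbabilityMeasure`, it carries the weak-* topology. -/
abbrev Sim (Γ : Type*) [Group Γ] :=
  {μ : ProbabilityMeasure (Γ → UnitAddCircle) //
    ∀ α : Γ, MeasurePreserving (torusShift α) (μ : Measure (Γ → UnitAddCircle)) μ}

namespace Sim

/-- The shift, as an action of `Γ` that preserves the given sim. -/
def shiftAction {Γ : Type*} [Group Γ] (μ : Sim Γ) :
    MPAction Γ (μ.1 : Measure (Γ → UnitAddCircle)) where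
  map := torusShift
  measurePreserving := μ.2
  map_one := by
    funext y γ
    simp [torusShift]
  map_mul β α := by
    funext y γ
    simp [torusShift, mul_assoc]

end Sim

/-!
Freeness is a `G_δ` condition on both sides, because it says that for each `α ≠ 1` the fixed-point set
of the transformation at time `α` is null, and the measure of that set is an upper semicontinuous
function of the action (or of the shift-invariant measure). For shift-invariant measures this is the
portmanteau theorem, since the fixed-point set of a shift is closed (`Sim.isGδ_isFree`). For actions
on `Y`, a sequence of sets `A k` separating points exhibits the set of points moved by `T^α` as the
increasing union of finite unions of the sets `A k ∆ (T^α)⁻¹(A k)`, whose measures are continuous in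
the coarse topology (`MPAction.isGδ_isFree`).

Density comes from the Bernoulli action of `Γ` on `Z = [0, 1]^Γ`. It is free because two distinct
coordinates of a random point almost surely differ, and hence its product with any action is free.

* For an action `T` on `Y`, the product with the Bernoulli action lives on `Y × Z`, which is again an
  atomless standard Borel probability space. Any two such spaces are isomorphic modulo null sets, by
  way of the quantile transform, and the isomorphism may be chosen piece by piece, to match any
  finite partition of `Y` with the partition of `Y × Z` into cylinders over it
  (`exists_aemeasureEquiv_of_map_eq`). Transporting the product action to `Y` along such an
  isomorphism gives a free action that agrees exactly with `T` on finitely many prescribed sets at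
  finitely many prescribed times (`MPAction.exists_isFree_preimage_ae_eq`), so that these actions
  converge to `T` along the directed set of finite prescriptions.
* For a shift-invariant measure `ν` on the product of circles, adding to each coordinate of a random
  point of law `ν` an independent variable uniform on `[0, 1 / (n + 2)]` gives a shift-invariant
  measure (`Sim.perturbation`). It is free, because the noise makes any two distinct coordinates
  almost surely different, and it tends to `ν` because the perturbed point tends to the
  original one pointwise.
-/

/-! ### Isomorphisms modulo null sets -/

/-- An isomorphism of measure spaces modulo null sets: a pair of everywhere defined
measure-preserving maps that are inverse to each other almost everywhere. -/
structure AEMeasureEquiv {X X' : Type*} [MeasurableSpace X] [MeasurableSpace X']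
    (μ : Measure X) (ν : Measure X') where
  /-- The forward map. -/
  toFun : X → X'
  /-- The backward map. -/
  invFun : X' → X
  measurePreserving_toFun : MeasurePreserving toFun μ ν
  measurePreserving_invFun : MeasurePreserving invFun ν μ
  left_inv : ∀ᵐ x ∂μ, invFun (toFun x) = x
  right_inv : ∀ᵐ y ∂ν, toFun (invFun y) = y

namespace AEMeasureEquiv

variable {X X' X'' : Type*} [MeasurableSpace X] [MeasurableSpace X'] [MeasurableSpace X'']
  {μ : Measure X} {ν : Measure X'} {ρ : Measure X''}

/-- The inverse isomorphism. -/
def symm (e : AEMeasureEquiv μ ν) : AEMeasureEquiv ν μ where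
  toFun := e.invFun
  invFun := e.toFun
  measurePreserving_toFun := e.measurePreserving_invFun
  measurePreserving_invFun := e.measurePreserving_toFun
  left_inv := e.right_inv
  right_inv := e.left_inv

/-- The composition of two isomorphisms. -/
def trans (e : AEMeasureEquiv μ ν) (e' : AEMeasureEquiv ν ρ) : AEMeasureEquiv μ ρ where
  toFun := e'.toFun ∘ e.toFun
  invFun := e.invFun ∘ e'.invFun
  measurePreserving_toFun := e'.measurePreserving_toFun.comp e.measurePreserving_toFun
  measurePreserving_invFun := e.measurePreserving_invFun.comp e'.measurePreserving_invFun
  left_inv := by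
    filter_upwards [e.left_inv,
      e.measurePreserving_toFun.quasiMeasurePreserving.ae e'.left_inv] with x h h'
    simp [h, h']
  right_inv := by
    filter_upwards [e'.right_inv,
      e'.measurePreserving_invFun.quasiMeasurePreserving.ae e.right_inv] with x h h'
    simp [h, h']

/-- Rescaling both measures by the same constant. -/
def smul (e : AEMeasureEquiv μ ν) (c : ENNReal) : AEMeasureEquiv (c • μ) (c • ν) where
  toFun := e.toFun
  invFun := e.invFun
  measurePreserving_toFun := e.measurePreserving_toFun.smul_measure c
  measurePreserving_invFun := e.measurePreserving_invFun.smul_measure c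
  left_inv := Measure.ae_smul_measure e.left_inv c
  right_inv := Measure.ae_smul_measure e.right_inv c

end AEMeasureEquiv

section Gluing

variable {X X' I : Type*} [MeasurableSpace X] [MeasurableSpace X'] [MeasurableSpace I]
  [Countable I] [MeasurableSingletonClass I] {μ : Measure X} {ν : Measure X'}
  {p : X → I} {q : X' → I}

theorem measure_eq_tsum_restrict_fiber (μ : Measure X) (hp : Measurable p) {s : Set X}
    (hs : MeasurableSet s) : μ s = ∑' i, μ.restrict (p ⁻¹' {i}) s := by
  have h := tsum_measure_preimage_singleton (μ := μ.restrict s) (s := (Set.univ : Set I))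
    Set.countable_univ (f := p) fun i _ => hp (measurableSet_singleton i)
  rw [Set.preimage_univ, Measure.restrict_apply_univ,
    tsum_univ (fun i => μ.restrict s (p ⁻¹' {i}))] at h
  rw [← h]
  refine tsum_congr fun i => ?_
  rw [Measure.restrict_apply (hp (measurableSet_singleton i)), Measure.restrict_apply hs,
    Set.inter_comm]

theorem ae_iff_forall_ae_restrict_fiber (hp : Measurable p) {P : X → Prop} :
    (∀ᵐ x ∂μ, P x) ↔ ∀ i, ∀ᵐ x ∂μ.restrict (p ⁻¹' {i}), P x := by
  refine ⟨fun h i => ae_restrict_of_ae h, fun h => ?_⟩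
  have h' : ∀ i, ∀ᵐ x ∂μ, p x = i → P x := fun i =>
    (ae_restrict_iff' (hp (measurableSet_singleton i))).1 (h i)
  filter_upwards [ae_all_iff.2 h'] with x hx using hx _ rfl

/-- Maps that are measure-preserving from fibre to fibre glue to a measure-preserving map. -/
theorem measurePreserving_glue (hp : Measurable p) (hq : Measurable q) {f : I → X → X'}
    (hf : ∀ i, MeasurePreserving (f i) (μ.restrict (p ⁻¹' {i})) (ν.restrict (q ⁻¹' {i}))) :
    MeasurePreserving (fun x => f (p x) x) μ ν := by
  have hm : Measurable fun x => f (p x) x :=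
    (measurable_from_prod_countable_right fun i => (hf i).measurable :
      Measurable fun z : I × X => f z.1 z.2).comp (hp.prodMk measurable_id)
  refine ⟨hm, Measure.ext fun s hs => ?_⟩
  rw [Measure.map_apply hm hs, measure_eq_tsum_restrict_fiber μ hp (hm hs),
    measure_eq_tsum_restrict_fiber ν hq hs]
  refine tsum_congr fun i => ?_
  rw [← (hf i).measure_preimage hs.nullMeasurableSet]
  refine measure_congr ?_
  filter_upwards [ae_restrict_mem (hp (measurableSet_singleton i))] with x hx
  have hx' : p x = i := hx
  change (f (p x) x ∈ s) = (f i x ∈ s)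
  rw [hx']

theorem ae_fiber_of_measurePreserving (hp : Measurable p) (hq : Measurable q) {f : I → X → X'}
    (hf : ∀ i, MeasurePreserving (f i) (μ.restrict (p ⁻¹' {i})) (ν.restrict (q ⁻¹' {i}))) :
    ∀ᵐ x ∂μ, q (f (p x) x) = p x := by
  refine (ae_iff_forall_ae_restrict_fiber hp).2 fun i => ?_
  filter_upwards [ae_restrict_mem (hp (measurableSet_singleton i)),
    (hf i).quasiMeasurePreserving.ae (ae_restrict_mem (hq (measurableSet_singleton i)))] with x hx h
  have hx' : p x = i := hx
  rw [hx']
  exact h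

theorem ae_leftInverse_glue (hp : Measurable p) (hq : Measurable q) {f : I → X → X'}
    {g : I → X' → X}
    (hf : ∀ i, MeasurePreserving (f i) (μ.restrict (p ⁻¹' {i})) (ν.restrict (q ⁻¹' {i})))
    (hfg : ∀ i, ∀ᵐ x ∂μ.restrict (p ⁻¹' {i}), g i (f i x) = x) :
    ∀ᵐ x ∂μ, g (q (f (p x) x)) (f (p x) x) = x := by
  have h : ∀ᵐ x ∂μ, g (p x) (f (p x) x) = x := by
    refine (ae_iff_forall_ae_restrict_fiber hp).2 fun i => ?_
    filter_upwards [ae_restrict_mem (hp (measurableSet_singleton i)), hfg i] with x hx h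
    have hx' : p x = i := hx
    rw [hx', h]
  filter_upwards [h, ae_fiber_of_measurePreserving hp hq hf] with x h₁ h₂
  rw [h₂, h₁]

/-- Isomorphisms between corresponding fibres glue to an isomorphism of the whole spaces. -/
def AEMeasureEquiv.glue (hp : Measurable p) (hq : Measurable q)
    (e : ∀ i, AEMeasureEquiv (μ.restrict (p ⁻¹' {i})) (ν.restrict (q ⁻¹' {i}))) :
    AEMeasureEquiv μ ν where
  toFun x := (e (p x)).toFun x
  invFun y := (e (q y)).invFun y
  measurePreserving_toFun :=
    measurePreserving_glue hp hq fun i => (e i).measurePreserving_toFun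
  measurePreserving_invFun :=
    measurePreserving_glue hq hp fun i => (e i).measurePreserving_invFun
  left_inv := ae_leftInverse_glue (f := fun i => (e i).toFun) (g := fun i => (e i).invFun) hp hq
    (fun i => (e i).measurePreserving_toFun) fun i => (e i).left_inv
  right_inv := ae_leftInverse_glue (f := fun i => (e i).invFun) (g := fun i => (e i).toFun) hq hp
    (fun i => (e i).measurePreserving_invFun) fun i => (e i).right_inv

end Gluing

/-! ### Atomless standard Borel spaces -/

theorem continuous_cdf (μ : Measure ℝ) [IsProbabilityMeasure μ] [NullSingletonClass μ] :
    Continuous (ProbabilityTheory.cdf μ) := by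
  refine continuous_iff_continuousAt.2 fun x => ?_
  rw [(ProbabilityTheory.cdf μ).mono.continuousAt_iff_leftLim_eq_rightLim,
    (ProbabilityTheory.cdf μ).rightLim_eq]
  have h := (ProbabilityTheory.cdf μ).measure_singleton x
  rw [ProbabilityTheory.measure_cdf, measure_singleton, eq_comm, ENNReal.ofReal_eq_zero] at h
  exact le_antisymm ((ProbabilityTheory.cdf μ).mono.leftLim_le le_rfl) (by linarith)

/-- The uniform distribution on `(0, 1)`, as a measure on `ℝ`. -/
noncomputable def uniformMeasure : Measure ℝ := volume.restrict (Set.Ioo 0 1)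

instance : IsProbabilityMeasure uniformMeasure := ⟨by simp [uniformMeasure]⟩

/-- The quantile transform: an atomless distribution on `ℝ` has a continuous distribution function
`F`, for which `G t = sup {x | F x ≤ t}` is a right inverse on `(0, 1)`; moreover `G` carries the
uniform distribution to the given one. -/
theorem exists_aemeasureEquiv_uniform_real (μ : Measure ℝ) [IsProbabilityMeasure μ]
    [NullSingletonClass μ] : Nonempty (AEMeasureEquiv μ uniformMeasure) := by
  classical
  set F := ProbabilityTheory.cdf μ
  have hcont : Continuous F := continuous_cdf μ
  have hmono : Monotone F := F.mono
  -- The value `0` outside `(0, 1)` does not matter: `uniformMeasure` gives no mass to that set.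
  let G : ℝ → ℝ := fun t => if t ∈ Set.Ioo (0 : ℝ) 1 then sSup {x | F x ≤ t} else 0
  have hbdd : ∀ t < (1 : ℝ), BddAbove {x | F x ≤ t} := by
    intro t ht
    obtain ⟨b, hb⟩ := ((ProbabilityTheory.tendsto_cdf_atTop μ).eventually
      (lt_mem_nhds ht)).exists
    exact ⟨b, fun x hx => le_of_not_gt fun hlt => absurd (hmono hlt.le)
      (not_le.2 (lt_of_le_of_lt hx hb))⟩
  have hne : ∀ t > (0 : ℝ), ({x | F x ≤ t}).Nonempty := by
    intro t ht
    obtain ⟨b, hb⟩ := ((ProbabilityTheory.tendsto_cdf_atBot μ).eventually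
      (gt_mem_nhds ht)).exists
    exact ⟨b, hb.le⟩
  have hG : ∀ t ∈ Set.Ioo (0 : ℝ) 1, G t = sSup {x | F x ≤ t} := fun t ht => if_pos ht
  have hle : ∀ t ∈ Set.Ioo (0 : ℝ) 1, F (G t) ≤ t := by
    intro t ht
    rw [hG t ht]
    exact (isClosed_le hcont continuous_const).csSup_mem (hne t ht.1) (hbdd t ht.2)
  -- By continuity the supremum is attained, and `F` and `G` form a Galois connection.
  have hgal : ∀ t ∈ Set.Ioo (0 : ℝ) 1, ∀ x, F x ≤ t ↔ x ≤ G t := by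
    intro t ht x
    refine ⟨fun h => ?_, fun h => (hmono h).trans (hle t ht)⟩
    rw [hG t ht]
    exact le_csSup (hbdd t ht.2) h
  have hFG : ∀ t ∈ Set.Ioo (0 : ℝ) 1, F (G t) = t := by
    intro t ht
    refine le_antisymm (hle t ht) (ge_of_tendsto (x := 𝓝[>] (G t))
      ((hcont.tendsto _).mono_left nhdsWithin_le_nhds) ?_)
    filter_upwards [self_mem_nhdsWithin] with y hy
    exact (lt_of_not_ge fun h => not_le.2 hy ((hgal t ht y).1 h)).le
  have hGm : Measurable G := by
    refine measurable_of_Ici fun x => ?_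
    have : G ⁻¹' Set.Ici x = (Set.Ioo 0 1 ∩ Set.Ici (F x)) ∪ ((Set.Ioo 0 1)ᶜ ∩ {_t | x ≤ 0}) := by
      ext t
      by_cases ht : t ∈ Set.Ioo (0 : ℝ) 1
      · simp only [Set.mem_preimage, Set.mem_Ici, Set.mem_union, Set.mem_inter_iff, ht, true_and,
          Set.mem_compl_iff, not_true_eq_false, false_and, or_false]
        exact (hgal t ht x).symm
      · have h0 : G t = 0 := if_neg ht
        simp [ht, h0]
    rw [this]
    exact (measurableSet_Ioo.inter measurableSet_Ici).union
      (measurableSet_Ioo.compl.inter (MeasurableSet.const _))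
  have hmap : uniformMeasure.map G = μ := by
    have : IsProbabilityMeasure (uniformMeasure.map G) :=
      Measure.isProbabilityMeasure_map hGm.aemeasurable
    -- The preimage of `[x, ∞)` is `[F x, 1)` up to a null set, of length `1 - F x = μ [x, ∞)`.
    refine Measure.ext_of_Ici _ _ fun x => ?_
    rw [Measure.map_apply hGm measurableSet_Ici, uniformMeasure,
      Measure.restrict_apply (hGm measurableSet_Ici)]
    have h1 : G ⁻¹' Set.Ici x ∩ Set.Ioo 0 1 = Set.Ici (F x) ∩ Set.Ioo 0 1 := by
      ext t
      simp only [Set.mem_inter_iff, Set.mem_preimage, Set.mem_Ici, and_congr_left_iff]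
      exact fun ht => (hgal t ht x).symm
    have h2 : (Set.Ici (F x) ∩ Set.Ioo 0 1 : Set ℝ) =ᵐ[volume] Set.Ico (F x) 1 := by
      have : (Set.Ici (F x) ∩ Set.Icc 0 1 : Set ℝ) = Set.Icc (F x) 1 := by
        ext t
        have := ProbabilityTheory.cdf_nonneg μ x
        simp only [Set.mem_inter_iff, Set.mem_Ici, Set.mem_Icc]
        constructor
        · rintro ⟨h, -, h'⟩; exact ⟨h, h'⟩
        · rintro ⟨h, h'⟩; exact ⟨h, this.trans h, h'⟩
      refine (ae_eq_set_inter (ae_eq_refl _) Ioo_ae_eq_Icc).trans ?_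
      rw [this]
      exact Ico_ae_eq_Icc.symm
    rw [h1, measure_congr h2, Real.volume_Ico, ← measure_congr (Ioi_ae_eq_Ici (μ := μ) (a := x)),
      ← Set.compl_Iic, prob_compl_eq_one_sub measurableSet_Iic, ← ProbabilityTheory.ofReal_cdf,
      ENNReal.ofReal_sub _ (ProbabilityTheory.cdf_nonneg μ x), ENNReal.ofReal_one]
  have hGp : MeasurePreserving G uniformMeasure μ := ⟨hGm, hmap⟩
  have hr : ∀ᵐ t ∂uniformMeasure, F (G t) = t := by
    filter_upwards [ae_restrict_mem measurableSet_Ioo] with t ht using hFG t ht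
  have hFp : MeasurePreserving F μ uniformMeasure := by
    refine ⟨hcont.measurable, ?_⟩
    rw [← hmap, Measure.map_map hcont.measurable hGm]
    conv_rhs => rw [← Measure.map_id (μ := uniformMeasure)]
    exact Measure.map_congr hr
  refine ⟨⟨F, G, hFp, hGp, ?_, hr⟩⟩
  -- `G (F x) = x` holds on the image of `G`, which has full measure.
  have hset : MeasurableSet {x | G (F x) = x} :=
    measurableSet_eq_fun (hGm.comp hcont.measurable) measurable_id
  rw [← hmap, ae_map_iff hGm.aemeasurable hset]
  filter_upwards [hr] with t ht
  rw [ht]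

theorem nullSingletonClass_map {X X' : Type*} [MeasurableSpace X] [MeasurableSpace X']
    {μ : Measure X} [NullSingletonClass μ] {f : X → X'} (hf : MeasurableEmbedding f) :
    NullSingletonClass (μ.map f) := by
  refine ⟨fun x => ?_⟩
  rw [hf.map_apply]
  exact (Set.subsingleton_singleton.preimage hf.injective).measure_zero μ

theorem exists_aemeasureEquiv_uniform {X : Type*} [MeasurableSpace X] [StandardBorelSpace X]
    (μ : Measure X) [IsProbabilityMeasure μ] [NullSingletonClass μ] :
    Nonempty (AEMeasureEquiv μ uniformMeasure) := by
  have : Nonempty X := nonempty_of_isProbabilityMeasure μ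
  have he := measurableEmbedding_embeddingReal X
  have := nullSingletonClass_map (μ := μ) he
  have : IsProbabilityMeasure (μ.map (embeddingReal X)) :=
    Measure.isProbabilityMeasure_map he.measurable.aemeasurable
  obtain ⟨e⟩ := exists_aemeasureEquiv_uniform_real (μ.map (embeddingReal X))
  have hinv : ∀ x, he.invFun (embeddingReal X x) = x := he.leftInverse_invFun
  let e' : AEMeasureEquiv μ (μ.map (embeddingReal X)) :=
    { toFun := embeddingReal X
      invFun := he.invFun
      measurePreserving_toFun := ⟨he.measurable, rfl⟩
      measurePreserving_invFun := by
        refine ⟨he.measurable_invFun, ?_⟩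
        rw [Measure.map_map he.measurable_invFun he.measurable, he.leftInverse_invFun.comp_eq_id,
          Measure.map_id]
      left_inv := ae_of_all _ hinv
      right_inv := by
        rw [he.ae_map_iff]
        exact ae_of_all _ fun x => congrArg _ (hinv x) }
  exact ⟨e'.trans e⟩

theorem exists_aemeasureEquiv_smul_uniform {X : Type*} [MeasurableSpace X] [StandardBorelSpace X]
    (μ : Measure X) [IsFiniteMeasure μ] [NullSingletonClass μ] (h : μ Set.univ ≠ 0) :
    Nonempty (AEMeasureEquiv μ (μ Set.univ • uniformMeasure)) := by
  have : NeZero μ := ⟨fun h0 => h (by simp [h0])⟩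
  have : NullSingletonClass ((μ Set.univ)⁻¹ • μ) := ⟨fun x => by simp⟩
  obtain ⟨e⟩ := exists_aemeasureEquiv_uniform ((μ Set.univ)⁻¹ • μ)
  have e' := e.smul (μ Set.univ)
  rw [smul_smul, ENNReal.mul_inv_cancel h (measure_ne_top _ _), one_smul] at e'
  exact ⟨e'⟩

/-- Two atomless finite measures of the same total mass on standard Borel spaces are isomorphic
modulo null sets. The spaces must be nonempty for the maps to exist when the mass is zero. -/
theorem exists_aemeasureEquiv_of_measure_univ_eq {X X' : Type*} [MeasurableSpace X]
    [StandardBorelSpace X] [MeasurableSpace X'] [StandardBorelSpace X'] [Nonempty X] [Nonempty X']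
    (μ : Measure X) (ν : Measure X') [IsFiniteMeasure μ] [IsFiniteMeasure ν]
    [NullSingletonClass μ] [NullSingletonClass ν] (h : μ Set.univ = ν Set.univ) :
    Nonempty (AEMeasureEquiv μ ν) := by
  by_cases h0 : μ Set.univ = 0
  · obtain rfl : μ = 0 := Measure.measure_univ_eq_zero.1 h0
    obtain rfl : ν = 0 := Measure.measure_univ_eq_zero.1 (h ▸ h0)
    exact ⟨⟨fun _ => Classical.arbitrary X', fun _ => Classical.arbitrary X,
      ⟨measurable_const, by simp⟩, ⟨measurable_const, by simp⟩, by simp, by simp⟩⟩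
  · obtain ⟨e⟩ := exists_aemeasureEquiv_smul_uniform μ h0
    obtain ⟨e'⟩ := exists_aemeasureEquiv_smul_uniform ν (h ▸ h0)
    rw [← h] at e'
    exact ⟨e.trans e'.symm⟩

/-- A countable measurable partition can be matched by the isomorphism: if `p` and `q` have the
same distribution, some isomorphism carries the fibres of `p` to those of `q`. -/
theorem exists_aemeasureEquiv_of_map_eq {X X' I : Type*} [MeasurableSpace X]
    [StandardBorelSpace X] [MeasurableSpace X'] [StandardBorelSpace X'] [MeasurableSpace I]
    [Countable I] [MeasurableSingletonClass I]
    (μ : Measure X) (ν : Measure X') [IsProbabilityMeasure μ] [IsProbabilityMeasure ν]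
    [NullSingletonClass μ] [NullSingletonClass ν] {p : X → I} {q : X' → I}
    (hp : Measurable p) (hq : Measurable q) (h : μ.map p = ν.map q) :
    ∃ e : AEMeasureEquiv μ ν, ∀ᵐ x ∂μ, q (e.toFun x) = p x := by
  have : Nonempty X := nonempty_of_isProbabilityMeasure μ
  have : Nonempty X' := nonempty_of_isProbabilityMeasure ν
  have hfib : ∀ i, Nonempty
      (AEMeasureEquiv (μ.restrict (p ⁻¹' {i})) (ν.restrict (q ⁻¹' {i}))) := by
    intro i
    refine exists_aemeasureEquiv_of_measure_univ_eq _ _ ?_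
    have hi := congrArg (fun m : Measure I => m {i}) h
    simpa [Measure.map_apply hp (measurableSet_singleton i),
      Measure.map_apply hq (measurableSet_singleton i)] using hi
  let e := fun i => (hfib i).some
  exact ⟨AEMeasureEquiv.glue hp hq e, ae_fiber_of_measurePreserving
    (f := fun i => (e i).toFun) hp hq fun i => (e i).measurePreserving_toFun⟩

/-! ### Products, conjugates and freeness of actions -/

namespace MPAction

variable {Γ : Type*} [Group Γ] {X X' : Type*} [MeasurableSpace X] [MeasurableSpace X']
  {μ : Measure X} {ν : Measure X'}

/-- For a countable group, freeness can be tested one group element at a time. -/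
theorem isFree_iff [Countable Γ] (T : MPAction Γ μ) :
    T.IsFree ↔ ∀ α : Γ, α ≠ 1 → ∀ᵐ y ∂μ, T.map α y ≠ y := by
  have h1 : ∀ y, T.map 1 y = y := fun y => congrFun T.map_one y
  have hm : ∀ β α y, T.map (β * α) y = T.map β (T.map α y) := fun β α y =>
    congrFun (T.map_mul β α) y
  constructor
  · intro h α hα
    filter_upwards [h] with y hy hfix
    exact hα (hy (show T.map α y = T.map 1 y by rw [hfix, h1]))
  · intro h
    have h' : ∀ᵐ y ∂μ, ∀ α : Γ, α ≠ 1 → T.map α y ≠ y := by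
      refine ae_all_iff.2 fun α => ?_
      by_cases hα : α = 1
      · simp [hα]
      · filter_upwards [h α hα] with y hy _ using hy
    filter_upwards [h'] with y hy α β hαβ
    have hαβ' : T.map α y = T.map β y := hαβ
    by_contra hne
    refine hy (β⁻¹ * α) (fun h => hne (inv_mul_eq_one.1 h).symm) ?_
    rw [hm, hαβ', ← hm, inv_mul_cancel, h1]

/-- The diagonal action on the product space. -/
def prod [SFinite μ] [SFinite ν] (T : MPAction Γ μ) (R : MPAction Γ ν) :
    MPAction Γ (μ.prod ν) where
  map γ := Prod.map (T.map γ) (R.map γ)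
  measurePreserving γ := (T.measurePreserving γ).prod (R.measurePreserving γ)
  map_one := by rw [T.map_one, R.map_one, Prod.map_id]
  map_mul β α := by rw [T.map_mul, R.map_mul, Prod.map_comp_map]

theorem IsFree.prod_right [SFinite μ] [SFinite ν] (T : MPAction Γ μ) {R : MPAction Γ ν}
    (hR : R.IsFree) : (T.prod R).IsFree := by
  filter_upwards [Measure.quasiMeasurePreserving_snd.ae hR] with w hw α β h
  exact hw (congrArg Prod.snd h)

section Conjugate

variable (e : AEMeasureEquiv μ ν) (Q : MPAction Γ ν)

/-- The invariant set of full measure on which an action can be transported pointwise along an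
isomorphism modulo null sets. -/
def conjDomain : Set X :=
  {x | (∀ γ, e.toFun (e.invFun (Q.map γ (e.toFun x))) = Q.map γ (e.toFun x)) ∧
    e.invFun (e.toFun x) = x}

theorem measurableSet_conjDomain [Countable Γ] [StandardBorelSpace X] [StandardBorelSpace X'] :
    MeasurableSet (conjDomain e Q) := by
  have hf := e.measurePreserving_toFun.measurable
  have hg := e.measurePreserving_invFun.measurable
  have hQ := fun γ => (Q.measurePreserving γ).measurable
  have h1 : ∀ γ, MeasurableSet
      {x | e.toFun (e.invFun (Q.map γ (e.toFun x))) = Q.map γ (e.toFun x)} := fun γ =>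
    measurableSet_eq_fun (hf.comp (hg.comp ((hQ γ).comp hf))) ((hQ γ).comp hf)
  have h2 : MeasurableSet {x | e.invFun (e.toFun x) = x} :=
    measurableSet_eq_fun (hg.comp hf) measurable_id
  convert (MeasurableSet.iInter h1).inter h2 using 1
  ext x
  simp [conjDomain]

theorem ae_mem_conjDomain [Countable Γ] : ∀ᵐ x ∂μ, x ∈ conjDomain e Q := by
  have h : ∀ᵐ x ∂μ, ∀ γ, e.toFun (e.invFun (Q.map γ (e.toFun x))) = Q.map γ (e.toFun x) :=
    ae_all_iff.2 fun γ => ((Q.measurePreserving γ).comp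
      e.measurePreserving_toFun).quasiMeasurePreserving.ae e.right_inv
  filter_upwards [h, e.left_inv] with x h h' using ⟨h, h'⟩

theorem conj_mem_conjDomain {x : X} (hx : x ∈ conjDomain e Q) (γ : Γ) :
    e.invFun (Q.map γ (e.toFun x)) ∈ conjDomain e Q := by
  refine ⟨fun β => ?_, by rw [hx.1 γ]⟩
  have h := hx.1 (β * γ)
  rw [Q.map_mul] at h
  rw [hx.1 γ]
  exact h

open Classical in
/-- The transport of an action along an isomorphism modulo null sets. So that the action law holds
at every point, the action is taken to be trivial off `conjDomain`. -/
noncomputable def conj [Countable Γ] [StandardBorelSpace X] [StandardBorelSpace X'] :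
    MPAction Γ μ where
  map γ x := if x ∈ conjDomain e Q then e.invFun (Q.map γ (e.toFun x)) else x
  measurePreserving γ := by
    have hc : MeasurePreserving (fun x => e.invFun (Q.map γ (e.toFun x))) μ μ :=
      e.measurePreserving_invFun.comp ((Q.measurePreserving γ).comp e.measurePreserving_toFun)
    refine ⟨Measurable.ite (measurableSet_conjDomain e Q) hc.measurable measurable_id, ?_⟩
    refine (Measure.map_congr ?_).trans hc.map_eq
    filter_upwards [ae_mem_conjDomain e Q] with x hx
    rw [if_pos hx]
  map_one := by
    funext x
    by_cases hx : x ∈ conjDomain e Q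
    · rw [if_pos hx, Q.map_one]
      exact hx.2
    · rw [if_neg hx, id]
  map_mul β α := by
    funext x
    by_cases hx : x ∈ conjDomain e Q
    · simp only [Function.comp_apply, if_pos hx, if_pos (conj_mem_conjDomain e Q hx α), hx.1 α,
        Q.map_mul]
    · simp only [Function.comp_apply, if_neg hx]

theorem conj_ae_eq [Countable Γ] [StandardBorelSpace X] [StandardBorelSpace X'] (γ : Γ) :
    ∀ᵐ x ∂μ, (conj e Q).map γ x = e.invFun (Q.map γ (e.toFun x)) := by
  filter_upwards [ae_mem_conjDomain e Q] with x hx using if_pos hx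

theorem isFree_conj [Countable Γ] [StandardBorelSpace X] [StandardBorelSpace X']
    {Q : MPAction Γ ν} (hQ : Q.IsFree) : (conj e Q).IsFree := by
  filter_upwards [ae_mem_conjDomain e Q,
    e.measurePreserving_toFun.quasiMeasurePreserving.ae hQ] with x hx hfree α β h
  have h' : e.invFun (Q.map α (e.toFun x)) = e.invFun (Q.map β (e.toFun x)) := by
    simpa only [conj, if_pos hx] using h
  refine hfree (?_ : Q.map α (e.toFun x) = Q.map β (e.toFun x))
  rw [← hx.1 α, h', hx.1 β]

end Conjugate

end MPAction

/-! ### The Bernoulli action -/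

open unitInterval in
/-- The product over `Γ` of copies of the unit interval with Lebesgue measure. -/
noncomputable def bernoulliMeasure (Γ : Type*) : Measure (Γ → I) :=
  Measure.infinitePi fun _ => volume

instance (Γ : Type*) : IsProbabilityMeasure (bernoulliMeasure Γ) := by
  unfold bernoulliMeasure; infer_instance

open unitInterval in
/-- The Bernoulli action: the shift on the product over `Γ` of copies of the unit interval. -/
noncomputable def bernoulliAction (Γ : Type*) [Group Γ] : MPAction Γ (bernoulliMeasure Γ) where
  map α z γ := z (γ * α)
  measurePreserving α := by
    have hm : Measurable fun (z : Γ → I) γ => z (γ * α) :=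
      measurable_pi_lambda _ fun γ => measurable_pi_apply _
    refine ⟨hm, ?_⟩
    have h := Measure.infinitePi_map_piCongrLeft (X := fun _ : Γ => I)
      (fun _ : Γ => (volume : Measure I)) (Equiv.mulRight α⁻¹)
    change Measure.map _ (Measure.infinitePi _) = Measure.infinitePi _
    convert h using 2
    funext z γ
    obtain ⟨γ, rfl⟩ := (Equiv.mulRight α⁻¹).surjective γ
    rw [MeasurableEquiv.coe_piCongrLeft, Equiv.piCongrLeft_apply_apply]
    simp
  map_one := by funext z γ; simp
  map_mul β α := by funext z γ; simp [mul_assoc]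

open unitInterval in
/-- Distinct coordinates are independent with atomless laws, so no relation between them that
determines the second coordinate from the first has positive probability. -/
theorem ae_bernoulli_ne {Γ : Type*} {E : Type*} [MeasurableSpace E] [MeasurableEq E]
    {φ ψ : I → E} (hφ : Measurable φ) (hψ : Measurable ψ) (hinj : Function.Injective ψ)
    {α β : Γ} (hαβ : α ≠ β) : ∀ᵐ z ∂bernoulliMeasure Γ, φ (z α) ≠ ψ (z β) := by
  have hind : ProbabilityTheory.IndepFun (fun z : Γ → I => z α) (fun z => z β)
      (bernoulliMeasure Γ) :=
    (ProbabilityTheory.iIndepFun_infinitePi (P := fun _ : Γ => (volume : Measure I))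
      (X := fun _ => id) fun _ => measurable_id).indepFun hαβ
  have hlaw : (bernoulliMeasure Γ).map (fun z => (z α, z β)) =
      (volume : Measure I).prod volume := by
    rw [(ProbabilityTheory.indepFun_iff_map_prod_eq_prod_map_map
      (measurable_pi_apply α).aemeasurable (measurable_pi_apply β).aemeasurable).1 hind]
    unfold bernoulliMeasure
    rw [(measurePreserving_eval_infinitePi (fun _ : Γ => (volume : Measure I)) α).map_eq,
      (measurePreserving_eval_infinitePi (fun _ : Γ => (volume : Measure I)) β).map_eq]
  have hset : MeasurableSet {w : I × I | φ w.1 ≠ ψ w.2} :=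
    (measurableSet_eq_fun (hφ.comp measurable_fst) (hψ.comp measurable_snd)).compl
  have hae : ∀ᵐ w ∂(volume : Measure I).prod volume, φ w.1 ≠ ψ w.2 := by
    rw [Measure.ae_prod_iff_ae_ae hset]
    refine ae_of_all _ fun s => ?_
    have : ({t | ψ t = φ s} : Set I).Subsingleton := fun t ht t' ht' =>
      hinj ((show ψ t = φ s from ht).trans (show ψ t' = φ s from ht').symm)
    filter_upwards [compl_mem_ae_iff.2 (this.measure_zero volume)] with t ht h
    exact ht h.symm
  rw [← hlaw] at hae
  exact ae_of_ae_map ((measurable_pi_apply α).prodMk (measurable_pi_apply β)).aemeasurable hae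

theorem isFree_bernoulliAction (Γ : Type*) [Group Γ] [Countable Γ] :
    (bernoulliAction Γ).IsFree := by
  rw [MPAction.isFree_iff]
  intro α hα
  filter_upwards [ae_bernoulli_ne measurable_id measurable_id Function.injective_id hα] with z hz h
  refine hz ?_
  have := congrFun h 1
  simpa [bernoulliAction] using this

/-! ### Density and genericity of free actions -/

namespace MPAction

/-- For a sequence of sets that separates points, the union of the sets `A k ∆ (T^α)⁻¹(A k)` is the
set of points moved by `T^α`. The measure of the union of the first `n` depends continuously on the
action. -/
theorem continuous_measure_iUnion_symmDiff {Γ : Type*} [Group Γ] {Y : Type*} [MeasurableSpace Y]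
    {μ : Measure Y} [IsProbabilityMeasure μ] (α : Γ) {A : ℕ → Set Y}
    (hA : ∀ k, MeasurableSet (A k)) (n : ℕ) :
    Continuous fun T : MPAction Γ μ => μ (⋃ k < n, A k ∆ (T.map α ⁻¹' A k)) := by
  refine continuous_iff_continuousAt.2 fun T => ?_
  have hsub : ∀ T R : MPAction Γ μ, μ (⋃ k < n, A k ∆ (T.map α ⁻¹' A k)) ≤
      μ (⋃ k < n, A k ∆ (R.map α ⁻¹' A k)) +
      ∑ k ∈ Finset.range n, μ ((T.map α ⁻¹' A k) ∆ (R.map α ⁻¹' A k)) := by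
    intro T R
    refine le_trans (measure_mono ?_) ((measure_union_le _
      (⋃ k ∈ Finset.range n, (T.map α ⁻¹' A k) ∆ (R.map α ⁻¹' A k))).trans
      (add_le_add le_rfl (measure_biUnion_finset_le _ _)))
    intro y hy
    simp only [Set.mem_iUnion, Set.mem_union, Set.mem_symmDiff, Finset.mem_range] at hy ⊢
    obtain ⟨k, hk, h⟩ := hy
    by_cases hR : y ∈ R.map α ⁻¹' A k <;> by_cases hAk : y ∈ A k <;>
    · simp only [hAk] at h
      grind
  have hsum : Tendsto (fun R : MPAction Γ μ =>
      ∑ k ∈ Finset.range n, μ ((R.map α ⁻¹' A k) ∆ (T.map α ⁻¹' A k))) (𝓝 T) (𝓝 0) := by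
    have := tendsto_finsetSum (Finset.range n) fun k _ =>
      tendsto_iff.1 (tendsto_id (x := 𝓝 T)) α (A k) (hA k)
    simpa using this
  rw [ContinuousAt, ENNReal.tendsto_nhds (measure_ne_top _ _)]
  intro ε hε
  filter_upwards [(ENNReal.tendsto_nhds_zero.1 hsum) ε hε] with R hR
  refine ⟨tsub_le_iff_right.2 ((hsub T R).trans (add_le_add le_rfl ?_)),
    (hsub R T).trans (add_le_add le_rfl hR)⟩
  simpa only [symmDiff_comm] using hR

variable {Γ : Type*} [Group Γ] [Countable Γ] {Y : Type*} [MeasurableSpace Y]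
  [StandardBorelSpace Y] {μ : Measure Y} [IsProbabilityMeasure μ]

/-- The product of `T` with a Bernoulli action is free. Since `Y` and `Y × Z` are atomless, the
product can be transported to `Y` in such a way that finitely many prescribed sets, and their
preimages under `T`, correspond to their cylinders in `Y × Z`; on those sets the
transported action does exactly what `T` does. -/
theorem exists_isFree_preimage_ae_eq [NullSingletonClass μ] (T : MPAction Γ μ)
    (s : Finset (Γ × MeasuredSets μ)) :
    ∃ R : MPAction Γ μ, R.IsFree ∧ ∀ p ∈ s,
      R.map p.1 ⁻¹' (p.2 : Set Y) =ᵐ[μ] T.map p.1 ⁻¹' (p.2 : Set Y) := by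
  -- The prescribed sets, and their preimages under `T`, are unions of fibres of this labelling.
  let lab : Y → s → Prop × Prop := fun y i =>
    (y ∈ (i.1.2 : Set Y), T.map i.1.1 y ∈ (i.1.2 : Set Y))
  have hlab : Measurable lab := by
    refine measurable_pi_lambda _ fun i => ?_
    have hE : Measurable fun y => y ∈ (i.1.2 : Set Y) := measurable_mem.2 i.1.2.2
    exact hE.prodMk (hE.comp (T.measurePreserving i.1.1).measurable)
  obtain ⟨e, he⟩ := exists_aemeasureEquiv_of_map_eq μ (μ.prod (bernoulliMeasure Γ))
    (p := lab) (q := lab ∘ Prod.fst) hlab (hlab.comp measurable_fst) (by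
      rw [← Measure.map_map hlab measurable_fst, Measure.map_fst_prod, measure_univ, one_smul])
  have he' : ∀ᵐ w ∂μ.prod (bernoulliMeasure Γ), lab (e.invFun w) = lab w.1 := by
    filter_upwards [e.measurePreserving_invFun.quasiMeasurePreserving.ae he, e.right_inv]
      with w h h'
    rw [← h, h', Function.comp_apply]
  let Q := T.prod (bernoulliAction Γ)
  refine ⟨conj e Q, isFree_conj e ((isFree_bernoulliAction Γ).prod_right T), fun p hp => ?_⟩
  filter_upwards [conj_ae_eq e Q p.1, he, ((Q.measurePreserving p.1).comp
    e.measurePreserving_toFun).quasiMeasurePreserving.ae he'] with y h1 h2 h3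
  have h3' := congrArg Prod.fst (congrFun h3 ⟨p, hp⟩)
  have h2' := congrArg Prod.snd (congrFun h2 ⟨p, hp⟩)
  change ((conj e Q).map p.1 y ∈ (p.2 : Set Y)) = (T.map p.1 y ∈ (p.2 : Set Y))
  rw [h1]
  exact h3'.trans h2'

theorem dense_isFree [NullSingletonClass μ] : Dense {T : MPAction Γ μ | T.IsFree} := by
  intro T
  -- The approximations, indexed by finite sets of prescriptions, form a net converging to `T`.
  choose R hR hRT using T.exists_isFree_preimage_ae_eq
  refine mem_closure_of_tendsto (b := atTop) (f := R) ?_ (Eventually.of_forall hR)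
  refine tendsto_iff.2 fun γ E hE => ?_
  refine tendsto_const_nhds.congr' ?_
  filter_upwards [eventually_ge_atTop {((γ, ⟨E, hE⟩) : Γ × MeasuredSets μ)}] with s hs
  exact (measure_symmDiff_eq_zero_iff.2 (hRT s _ (Finset.singleton_subset_iff.1 hs))).symm

theorem isGδ_isFree : IsGδ {T : MPAction Γ μ | T.IsFree} := by
  let A : ℕ → Set Y := fun k => {y | MeasurableSpace.mapNatBool Y y k = true}
  have hA : ∀ k, MeasurableSet (A k) := fun k =>
    ((measurable_pi_apply k).comp (MeasurableSpace.measurable_mapNatBool Y))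
      (measurableSet_singleton true)
  let D : Γ → MPAction Γ μ → ℕ → Set Y := fun α T n => ⋃ k < n, A k ∆ (T.map α ⁻¹' A k)
  have hD : ∀ α T, ⋃ n, D α T n = {y | T.map α y ≠ y} := by
    intro α T
    ext y
    simp only [D, Set.mem_iUnion, Set.mem_ofPred_eq]
    constructor
    · rintro ⟨n, k, hk, h⟩ hy
      simp [Set.mem_symmDiff, hy] at h
    · intro hy
      obtain ⟨k, hk⟩ := Function.ne_iff.1
        ((MeasurableSpace.injective_mapNatBool Y).ne hy)
      refine ⟨k + 1, k, Nat.lt_succ_self k, ?_⟩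
      simp only [Set.mem_symmDiff, Set.mem_preimage, A, Set.mem_ofPred_eq]
      grind
  have hmono : ∀ α T, Monotone (D α T) := fun α T m n hmn =>
    Set.biUnion_subset_biUnion_left fun k hk => lt_of_lt_of_le hk hmn
  -- That almost every point is moved means that the measures of the sets `D α T n` exceed every
  -- rational number below `1`: countably many conditions, each of them open in `T`.
  have key : ∀ (α : Γ) (T : MPAction Γ μ), (∀ᵐ y ∂μ, T.map α y ≠ y) ↔
      ∀ q : ℚ, ((q : ℝ).toNNReal : ENNReal) < 1 → ∃ n, ((q : ℝ).toNNReal : ENNReal) <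
        μ (D α T n) := by
    intro α T
    have hset : MeasurableSet {y | T.map α y ≠ y} :=
      (measurableSet_eq_fun (T.measurePreserving α).measurable measurable_id).compl
    have h1 : (∀ᵐ y ∂μ, T.map α y ≠ y) ↔ 1 ≤ ⨆ n, μ (D α T n) := by
      rw [← (hmono α T).measure_iUnion, hD]
      exact (mem_ae_iff_prob_eq_one hset).trans
        ⟨fun h => h.ge, fun h => le_antisymm prob_le_one h⟩
    rw [h1]
    constructor
    · exact fun h q hq => lt_iSup_iff.1 (hq.trans_le h)
    · intro h
      by_contra! hlt
      obtain ⟨q, -, hq, hq1⟩ := ENNReal.lt_iff_exists_rat_btwn.1 hlt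
      obtain ⟨n, hn⟩ := h q hq1
      exact absurd (hn.trans_le (le_iSup (fun n => μ (D α T n)) n)) hq.not_gt
  have hset : {T : MPAction Γ μ | T.IsFree} = ⋂ (α : Γ) (_ : α ≠ 1) (q : ℚ)
      (_ : ((q : ℝ).toNNReal : ENNReal) < 1), ⋃ n,
        {T : MPAction Γ μ | ((q : ℝ).toNNReal : ENNReal) < μ (D α T n)} := by
    ext T
    simp only [Set.mem_iInter, Set.mem_iUnion, Set.mem_ofPred_eq]
    rw [isFree_iff]
    exact forall₂_congr fun α _ => key α T
  rw [hset]
  refine .iInter fun α => .iInter fun _ => .iInter fun q => .iInter fun _ => IsOpen.isGδ ?_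
  exact isOpen_iUnion fun n =>
    isOpen_lt continuous_const (continuous_measure_iUnion_symmDiff α hA n)

end MPAction

theorem Topology.IsInducing.isGδ_of_preimage {X X' : Type*} [TopologicalSpace X]
    [TopologicalSpace X'] {f : X → X'} (hf : Topology.IsInducing f) (hs : Function.Surjective f)
    {s : Set X'} (h : IsGδ (f ⁻¹' s)) : IsGδ s := by
  obtain ⟨u, hu, hsu⟩ := isGδ_iff_eq_iInter_nat.1 h
  choose v hv hvu using fun n => hf.isOpen_iff.1 (hu n)
  refine isGδ_iff_eq_iInter_nat.2 ⟨v, hv, hs.preimage_injective ?_⟩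
  simp only [Set.preimage_iInter, hvu, hsu]

namespace ActionSpace

theorem mk_surjective {Γ : Type*} [Group Γ] {Y : Type*} [MeasurableSpace Y] {μ : Measure Y} :
    Function.Surjective (mk : MPAction Γ μ → ActionSpace Γ μ) :=
  Quotient.mk_surjective

variable {Γ : Type*} [Group Γ] [Countable Γ] {Y : Type*} [MeasurableSpace Y]
  [StandardBorelSpace Y] {μ : Measure Y} [IsProbabilityMeasure μ]

theorem dense_isFree [NullSingletonClass μ] : Dense {T : ActionSpace Γ μ | T.IsFree} := by
  refine (mk_surjective.denseRange.dense_image isInducing_mk.continuous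
    MPAction.dense_isFree).mono ?_
  rintro _ ⟨T, hT, rfl⟩
  exact hT

theorem isGδ_isFree : IsGδ {T : ActionSpace Γ μ | T.IsFree} :=
  isInducing_mk.isGδ_of_preimage mk_surjective MPAction.isGδ_isFree

end ActionSpace

/-! ### Shift-invariant measures -/

namespace Sim

theorem continuous_torusShift {Γ : Type*} [Group Γ] (α : Γ) : Continuous (torusShift α) :=
  continuous_pi fun γ => continuous_apply (γ * α)

variable {Γ : Type*} [Group Γ] [Countable Γ]

theorem isGδ_isFree : IsGδ {ν : Sim Γ | ν.shiftAction.IsFree} := by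
  let F : Γ → Set (Γ → UnitAddCircle) := fun α => {y | torusShift α y = y}
  have hF : ∀ α, IsClosed (F α) := fun α => isClosed_eq (continuous_torusShift α) continuous_id
  have hset : {ν : Sim Γ | ν.shiftAction.IsFree} = ⋂ (α : Γ) (_ : α ≠ 1) (n : ℕ),
      {ν : Sim Γ | (ν.1 : Measure (Γ → UnitAddCircle)) (F α) < ((n : ENNReal) + 1)⁻¹} := by
    ext ν
    simp only [Set.mem_iInter, Set.mem_ofPred_eq]
    rw [MPAction.isFree_iff]
    refine forall₂_congr fun α _ => ?_
    have h0 : (∀ᵐ y ∂(ν.1 : Measure (Γ → UnitAddCircle)), ν.shiftAction.map α y ≠ y) ↔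
        (ν.1 : Measure (Γ → UnitAddCircle)) (F α) = 0 := by
      rw [ae_iff]
      simp only [not_not, ne_eq]
      rfl
    rw [h0]
    constructor
    · intro h n
      rw [h]
      simp
    · intro h
      by_contra hne
      obtain ⟨n, hn⟩ := ENNReal.exists_inv_nat_lt hne
      refine absurd (h n) (not_lt.2 (le_trans ?_ hn.le))
      exact ENNReal.inv_le_inv.2 le_self_add
  rw [hset]
  refine .iInter fun α => .iInter fun _ => .iInter fun n => IsOpen.isGδ ?_
  -- The measure of a closed set is upper semicontinuous.
  refine IsOpen.preimage (f := ((↑) : Sim Γ → ProbabilityMeasure (Γ → UnitAddCircle)))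
    (t := {ν | (ν : Measure (Γ → UnitAddCircle)) (F α) < ((n : ENNReal) + 1)⁻¹})
    continuous_subtype_val (isOpen_iff_eventually.2 fun ν hν => ?_)
  exact eventually_lt_of_limsup_lt
    ((ProbabilityMeasure.limsup_measure_closed_le_of_tendsto tendsto_id (hF α)).trans_lt hν)

open unitInterval in
/-- Perturbation of each coordinate of `y` by a small multiple of the corresponding coordinate
of `z`. The factor `1 / (n + 2)` is less than `1`, so that scaling the unit interval into the circle
is injective. -/
noncomputable def perturb (Γ : Type*) (n : ℕ) (w : (Γ → UnitAddCircle) × (Γ → I)) :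
    Γ → UnitAddCircle :=
  fun γ => w.1 γ + (((w.2 γ : ℝ) / (n + 2) : ℝ) : UnitAddCircle)

theorem measurable_perturb {Γ : Type*} [Countable Γ] (n : ℕ) : Measurable (perturb Γ n) := by
  refine Continuous.measurable (continuous_pi fun γ => ?_)
  refine ((continuous_apply γ).comp continuous_fst).add
    ((AddCircle.continuous_mk' 1).comp ?_)
  fun_prop

open unitInterval in
theorem injective_coe_div (n : ℕ) :
    Function.Injective fun t : I => (((t : ℝ) / (n + 2) : ℝ) : UnitAddCircle) := by
  have hn : (0 : ℝ) < n + 2 := by positivity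
  have hmem : ∀ t : I, (t : ℝ) / (n + 2) ∈ Set.Ico (0 : ℝ) (0 + 1) := by
    intro t
    refine ⟨div_nonneg t.2.1 hn.le, ?_⟩
    rw [zero_add, div_lt_one hn]
    linarith [t.2.2, (Nat.cast_nonneg n : (0 : ℝ) ≤ n)]
  intro s t h
  have h' := (AddCircle.coe_eq_coe_iff_of_mem_Ico (hmem s) (hmem t)).1 h
  exact Subtype.ext ((div_left_inj' hn.ne').1 h')

/-- The law of the perturbation of a random point of law `ν` by independent uniform variables. -/
noncomputable def perturbation (ν : Sim Γ) (n : ℕ) : Sim Γ :=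
  ⟨⟨((ν.1 : Measure (Γ → UnitAddCircle)).prod (bernoulliMeasure Γ)).map (perturb Γ n),
    Measure.isProbabilityMeasure_map (measurable_perturb n).aemeasurable⟩, fun α => by
    have hS : Measurable (torusShift α : (Γ → UnitAddCircle) → _) :=
      (continuous_torusShift α).measurable
    refine ⟨hS, ?_⟩
    have hQ := (ν.shiftAction.prod (bernoulliAction Γ)).measurePreserving α
    change Measure.map _ (Measure.map _ _) = Measure.map _ _
    rw [Measure.map_map hS (measurable_perturb n)]
    conv_rhs => rw [← hQ.map_eq]
    rw [Measure.map_map (measurable_perturb n) hQ.measurable]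
    rfl⟩

theorem isFree_perturbation (ν : Sim Γ) (n : ℕ) : (ν.perturbation n).shiftAction.IsFree := by
  rw [MPAction.isFree_iff]
  intro α hα
  have hS : Measurable (torusShift α : (Γ → UnitAddCircle) → _) :=
    (continuous_torusShift α).measurable
  have hset : MeasurableSet {y : Γ → UnitAddCircle | torusShift α y ≠ y} :=
    (measurableSet_eq_fun hS measurable_id).compl
  change ∀ᵐ y ∂((ν.1 : Measure (Γ → UnitAddCircle)).prod (bernoulliMeasure Γ)).map (perturb Γ n),
    torusShift α y ≠ y
  rw [ae_map_iff (measurable_perturb n).aemeasurable hset,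
    Measure.ae_prod_iff_ae_ae (p := fun w => torusShift α (perturb Γ n w) ≠ perturb Γ n w)
      (measurable_perturb n hset)]
  refine ae_of_all _ fun y => ?_
  have hm : ∀ c : UnitAddCircle, Measurable fun t : unitInterval =>
      c + (((t : ℝ) / (n + 2) : ℝ) : UnitAddCircle) := by
    intro c
    refine Continuous.measurable (continuous_const.add ((AddCircle.continuous_mk' 1).comp ?_))
    fun_prop
  filter_upwards [ae_bernoulli_ne (hm (y α)) (hm (y 1))
    ((add_right_injective (y 1)).comp (injective_coe_div n)) hα] with z hz h
  refine hz ?_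
  have := congrFun h 1
  simpa [torusShift, perturb] using this

theorem tendsto_perturbation (ν : Sim Γ) : Tendsto ν.perturbation atTop (𝓝 ν) := by
  rw [tendsto_subtype_rng]
  have hlim : ∀ w, Tendsto (fun n => perturb Γ n w) atTop (𝓝 w.1) := by
    intro w
    refine tendsto_pi_nhds.2 fun γ => ?_
    have h0 : Tendsto (fun n : ℕ => (w.2 γ : ℝ) / ((n : ℝ) + 2)) atTop (𝓝 0) :=
      tendsto_const_nhds.div_atTop
        (tendsto_atTop_add_const_right _ _ tendsto_natCast_atTop_atTop)
    have h1 := (tendsto_const_nhds (x := w.1 γ)).add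
      (((AddCircle.continuous_mk' (1 : ℝ)).tendsto 0).comp h0)
    rw [map_zero, add_zero] at h1
    exact h1
  have h := (tendstoInDistribution_of_ae_tendsto (l := atTop)
    (μ' := (ν.1 : Measure (Γ → UnitAddCircle)).prod (bernoulliMeasure Γ))
    (fun n => (measurable_perturb n).aemeasurable) measurable_fst.aemeasurable
    (ae_of_all _ hlim)).tendsto
  refine h.trans (le_of_eq (congrArg 𝓝 (Subtype.ext ?_)))
  change Measure.map Prod.fst _ = (ν.1 : Measure (Γ → UnitAddCircle))
  rw [Measure.map_fst_prod, measure_univ, one_smul]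

theorem dense_isFree : Dense {ν : Sim Γ | ν.shiftAction.IsFree} := fun ν =>
  mem_closure_of_tendsto ν.tendsto_perturbation (Eventually.of_forall ν.isFree_perturbation)

end Sim

theorem mainTheorem3 (Γ : Type*) [Group Γ] [Countable Γ]
    {Y : Type*} [MeasurableSpace Y] [StandardBorelSpace Y]
    (μ : Measure Y) [IsProbabilityMeasure μ] [NullSingletonClass μ] :
    {T : ActionSpace Γ μ | T.IsFree} ∈ residual (ActionSpace Γ μ) ∧
    Dense {T : ActionSpace Γ μ | T.IsFree} ∧
    IsGδ {ν : Sim Γ | ν.shiftAction.IsFree} ∧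
    Dense {ν : Sim Γ | ν.shiftAction.IsFree} :=
  ⟨residual_of_dense_Gδ ActionSpace.isGδ_isFree ActionSpace.dense_isFree,
    ActionSpace.dense_isFree, Sim.isGδ_isFree, Sim.dense_isFree⟩
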